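/- Let $N\ge 0$ and let $P$ be a convex polygon with $N+2$ vertices (for $N=0$, a single edge), colored cyclically $1,2,1,2,\ldots$ starting from a fixed vertex. A triangulation of $P$ is a set of diagonals of $P$, no two of which intersect in the interior of $P$, such that every bounded region of the graph formed by these diagonals and the sides of $P$ is a triangle (for $N=0$ the single edge, which has no bounded region, counts as a triangulation of itself). A triangulation is proper if none of its triangles is monochromatic, i.e. has all three vertices of the same color. Let $a_N$ be the number of proper triangulations of $P$. Then for every integer $n\ge 0$, $$a_{2n}=\frac{2^n}{2n+1}\binom{3n}{n}\qquad\text{and}\qquad a_{2n+1}=\frac{2^{n+1}}{2n+2}\binom{3n+1}{n}.$$ -/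

import Mathlib

/-!
The vertices of a convex `m`-gon are `0, 1, …, m - 1` (the elements of `Fin m`) in cyclic order.
For chords of a convex polygon, crossing in the interior depends only on the cyclic order of the
four end points: the chords `ac` and `bd` with four distinct end points cross exactly if the end
points interleave.
-/

namespace PolygonPartition

/-- `G` is a partition of the convex `m`-gon: a graph on its vertices that contains all the sides,
and in which no two chords cross in the interior of the polygon. -/
def IsPartition {m : ℕ} (G : SimpleGraph (Fin m)) : Prop :=
  SimpleGraph.cycleGraph m ≤ G ∧
    ∀ a b c d : Fin m, a < b → b < c → c < d → ¬ (G.Adj a c ∧ G.Adj b d)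

/-- For `a < b` in `S`: the vertices `a` and `b` are neighbours in the cyclic order on `S`, that is,
`ab` is a side of the convex polygon with vertex set `S`. -/
def IsSide {m : ℕ} (S : Finset (Fin m)) (a b : Fin m) : Prop :=
  (∀ c ∈ S, ¬ (a < c ∧ c < b)) ∨ (∀ c ∈ S, a ≤ c ∧ c ≤ b)

/-- `S` is the vertex set of a bounded region of the partition `G`: the sides of the polygon
spanned by `S` are edges of `G`, and no chord of `G` is a diagonal of this polygon. (A chord with
an end point outside `S` that entered the interior of the polygon would cross one of its sides.) -/
def IsRegion {m : ℕ} (G : SimpleGraph (Fin m)) (S : Finset (Fin m)) : Prop :=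
  3 ≤ S.card ∧ ∀ a ∈ S, ∀ b ∈ S, a < b → (G.Adj a b ↔ IsSide S a b)

/-- A triangulation is a partition all of whose bounded regions are triangles. A single edge
(`m = 2`) has no bounded region and is a triangulation of itself. -/
def IsTriangulation {m : ℕ} (G : SimpleGraph (Fin m)) : Prop :=
  IsPartition G ∧ ∀ S : Finset (Fin m), IsRegion G S → S.card = 3

/-- The cyclic coloring `1, 2, 1, 2, …` of the vertices. -/
def color {m : ℕ} (i : Fin m) : ℕ := (i : ℕ) % 2 + 1

/-- A triangulation is proper if none of its triangles is monochromatic. -/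
def IsProperTriangulation {m : ℕ} (G : SimpleGraph (Fin m)) : Prop :=
  IsTriangulation G ∧
    ∀ S : Finset (Fin m), IsRegion G S → ¬ ∃ k : ℕ, ∀ i ∈ S, color i = k

/-- `numProper N` is the number of proper triangulations of the `(N + 2)`-gon. -/
noncomputable def numProper (N : ℕ) : ℕ :=
  {G : SimpleGraph (Fin (N + 2)) | IsProperTriangulation G}.ncard

end PolygonPartition

/-!
A proper triangulation is determined locally: a noncrossing graph that contains the sides is a
proper triangulation exactly if every chord `ab` with `a + 1 < b` is the base of a two-coloured
triangle with apex strictly between `a` and `b` (`isProperTriangulation_iff`). For one direction,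
the region below `ab` is spanned by the vertices that no other chord separates from `ab`; for the
other, a region contains the apex over the side `ab` joining its extreme vertices, and no fourth
vertex.

Hence a proper triangulation splits at the apex `k` of the triangle on the base `(i, j)` into proper
triangulations of the polygons `i, …, k` and `k, …, j`, and conversely two such triangulations can be
glued (`card_properChordSets`). As the number depends only on `j - i`, separating the parities of
`k` gives, for `F = ∑ a₂ₙ Xⁿ`, that `∑ a₂ₙ₊₁ Xⁿ = F²` and `F = 1 + 2 X F³` (`evenSeries_eq`).

The coefficients of `F ^ r` are then the numbers `2ⁿ r / (3 n + r) * C(3 n + r, n)`, since both satisfy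
the recurrence read off from `F ^ (r + 1) = F ^ r + 2 X F ^ (r + 3)`
(`coeff_pow_of_eq_one_add_two_X_mul_cube`). The cases `r = 1` and `r = 2` are the two formulas.
-/

namespace PolygonPartition

/-! ### Regions and apexes -/

theorem exists_apex_of_isProperTriangulation {m : ℕ} {G : SimpleGraph (Fin m)}
    (hG : IsProperTriangulation G) {a b : Fin m} (hab : G.Adj a b) (hlt : (a : ℕ) + 1 < b) :
    ∃ k, a < k ∧ k < b ∧ G.Adj a k ∧ G.Adj k b ∧
      ¬ ((a : ℕ) % 2 = k % 2 ∧ (k : ℕ) % 2 = b % 2) := by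
  classical
  obtain ⟨⟨⟨hside, hcross⟩, htri⟩, hcol⟩ := hG
  have hlt' : a < b := by rw [Fin.lt_def]; omega
  have hsucc : ∀ x y : Fin m, (x : ℕ) + 1 = y → G.Adj x y := by
    intro x y hxy
    apply hside
    rw [SimpleGraph.cycleGraph_adj']
    right
    rw [Fin.sub_val_of_le (by rw [Fin.le_def]; omega)]
    omega
  -- The vertices of the region below `ab`: those that no other chord of `G` cuts off from `ab`.
  let S : Finset (Fin m) := Finset.univ.filter fun v => a ≤ v ∧ v ≤ b ∧
    ∀ c d, a ≤ c → d ≤ b → ¬ (c = a ∧ d = b) → G.Adj c d → ¬ (c < v ∧ v < d)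
  have hS : ∀ v, v ∈ S ↔ a ≤ v ∧ v ≤ b ∧
      ∀ c d, a ≤ c → d ≤ b → ¬ (c = a ∧ d = b) → G.Adj c d → ¬ (c < v ∧ v < d) := by
    intro v; simp [S]
  have haS : a ∈ S := (hS a).2 ⟨le_rfl, hlt'.le, fun c d hc _ _ _ h => absurd h.1 hc.not_gt⟩
  have hbS : b ∈ S := (hS b).2 ⟨hlt'.le, le_rfl, fun c d _ hd _ _ h => absurd h.2 hd.not_gt⟩
  -- From `x ∈ S`, the longest chord other than `ab` that stops at `y ∈ S` or before ends in `S`.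
  have hnext : ∀ x ∈ S, ∀ y ∈ S, x < y → ∃ z ∈ S, x < z ∧ z ≤ y ∧ G.Adj x z ∧
      ¬ (x = a ∧ z = b) := by
    intro x hx y hy hxy
    let Z : Finset (Fin m) :=
      Finset.univ.filter fun z => x < z ∧ z ≤ y ∧ G.Adj x z ∧ ¬ (x = a ∧ z = b)
    have hZ : Z.Nonempty := by
      have hy' := y.2
      rw [Fin.lt_def] at hxy
      refine ⟨⟨x + 1, by omega⟩, ?_⟩
      simp only [Z, Finset.mem_filter, Finset.mem_univ, true_and]
      refine ⟨by rw [Fin.lt_def]; simp, by rw [Fin.le_def]; simp; omega, hsucc _ _ rfl, ?_⟩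
      rintro ⟨rfl, h⟩
      rw [Fin.ext_iff] at h
      simp only at h
      omega
    have hmax := Z.max'_mem hZ
    set z := Z.max' hZ with hz
    obtain ⟨h1, h2, h3, h4⟩ := (Finset.mem_filter.1 hmax).2
    have hx' := (hS x).1 hx
    have hy' := (hS y).1 hy
    refine ⟨z, ?_, h1, h2, h3, h4⟩
    refine (hS z).2 ⟨hx'.1.trans h1.le, h2.trans hy'.2.1, ?_⟩
    rintro c d hc hd hcd hadj ⟨hcz, hzd⟩
    rcases lt_trichotomy c x with hcx | rfl | hxc
    · exact hx'.2.2 c d hc hd hcd hadj ⟨hcx, h1.trans hzd⟩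
    · rcases le_or_gt d y with hdy | hyd
      · have hdZ : d ∈ Z := by
          simp only [Z, Finset.mem_filter, Finset.mem_univ, true_and]
          exact ⟨h1.trans hzd, hdy, hadj, hcd⟩
        exact absurd (Z.le_max' d hdZ) hzd.not_ge
      · exact hy'.2.2 c d hc hd hcd hadj ⟨hxy, hyd⟩
    · exact hcross x c z d hxc hcz hzd ⟨h3, hadj⟩
  obtain ⟨z, hzS, haz, hzb, -, hzne⟩ := hnext a haS b hbS hlt'
  have hzb' : z < b := lt_of_le_of_ne hzb fun h => hzne ⟨rfl, h⟩
  have hreg : IsRegion G S := by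
    refine ⟨?_, ?_⟩
    · have : ({a, z, b} : Finset (Fin m)) ⊆ S := by
        intro v hv
        simp only [Finset.mem_insert, Finset.mem_singleton] at hv
        rcases hv with rfl | rfl | rfl <;> assumption
      calc 3 = ({a, z, b} : Finset (Fin m)).card := by
            rw [Finset.card_eq_three.2 ⟨a, z, b, haz.ne, hlt'.ne, hzb'.ne, rfl⟩]
        _ ≤ _ := Finset.card_le_card this
    · intro x hx y hy hxy
      have hx' := (hS x).1 hx
      have hy' := (hS y).1 hy
      constructor
      · intro hadj
        by_cases hxyab : x = a ∧ y = b
        · right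
          intro c hc
          have := (hS c).1 hc
          rw [hxyab.1, hxyab.2]
          exact ⟨this.1, this.2.1⟩
        · left
          intro c hc h
          exact ((hS c).1 hc).2.2 x y hx'.1 hy'.2.1 hxyab hadj h
      · rintro (h | h)
        · obtain ⟨w, hwS, hxw, hwy, hadj, -⟩ := hnext x hx y hy hxy
          rcases hwy.eq_or_lt with rfl | hwy
          · exact hadj
          · exact absurd ⟨hxw, hwy⟩ (h w hwS)
        · rw [le_antisymm (h a haS).1 hx'.1, le_antisymm hy'.2.1 (h b hbS).2]
          exact hab
  have hSeq : S = {a, z, b} := by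
    symm
    apply Finset.eq_of_subset_of_card_le
    · intro v hv
      simp only [Finset.mem_insert, Finset.mem_singleton] at hv
      rcases hv with rfl | rfl | rfl <;> assumption
    · rw [htri S hreg, Finset.card_eq_three.2 ⟨a, z, b, haz.ne, hlt'.ne, hzb'.ne, rfl⟩]
  have hmem : ∀ v ∈ S, v = a ∨ v = z ∨ v = b := by
    intro v hv; rw [hSeq] at hv; simpa using hv
  refine ⟨z, haz, hzb', ?_, ?_, ?_⟩
  · refine (hreg.2 a haS z hzS haz).2 (Or.inl ?_)
    rintro c hc ⟨h1, h2⟩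
    rcases hmem c hc with rfl | rfl | rfl
    · exact h1.false
    · exact h2.false
    · exact h2.asymm hzb'
  · refine (hreg.2 z hzS b hbS hzb').2 (Or.inl ?_)
    rintro c hc ⟨h1, h2⟩
    rcases hmem c hc with rfl | rfl | rfl
    · exact h1.asymm haz
    · exact h1.false
    · exact h2.false
  · rintro ⟨h1, h2⟩
    refine hcol S hreg ⟨color z, fun v hv => ?_⟩
    rcases hmem v hv with rfl | rfl | rfl <;> simp only [color] <;> omega

theorem exists_region_eq_apex {m : ℕ} {G : SimpleGraph (Fin m)} (hG : IsPartition G)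
    (hapex : ∀ a b : Fin m, G.Adj a b → (a : ℕ) + 1 < b → ∃ k, a < k ∧ k < b ∧ G.Adj a k ∧
      G.Adj k b ∧ ¬ ((a : ℕ) % 2 = k % 2 ∧ (k : ℕ) % 2 = b % 2))
    {S : Finset (Fin m)} (hS : IsRegion G S) :
    ∃ a k b, S = {a, k, b} ∧ a < k ∧ k < b ∧
      ¬ ((a : ℕ) % 2 = k % 2 ∧ (k : ℕ) % 2 = b % 2) := by
  classical
  obtain ⟨hcard, hreg⟩ := hS
  have hne : S.Nonempty := Finset.card_pos.1 (by omega)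
  obtain ⟨a, haS, hamin⟩ : ∃ a ∈ S, ∀ c ∈ S, a ≤ c :=
    ⟨S.min' hne, S.min'_mem hne, fun c hc => S.min'_le c hc⟩
  obtain ⟨b, hbS, hbmax⟩ : ∃ b ∈ S, ∀ c ∈ S, c ≤ b :=
    ⟨S.max' hne, S.max'_mem hne, fun c hc => S.le_max' c hc⟩
  obtain ⟨v, hvS, hva, hvb⟩ : ∃ v ∈ S, v ≠ a ∧ v ≠ b := by
    by_contra! h
    have hsub : S ⊆ {a, b} := by
      intro v hv
      by_cases hva : v = a
      · simp [hva]
      · simp [h v hv hva]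
    have := (Finset.card_le_card hsub).trans Finset.card_le_two
    omega
  have hav : a < v := lt_of_le_of_ne (hamin v hvS) hva.symm
  have hvb' : v < b := lt_of_le_of_ne (hbmax v hvS) hvb
  have hab : G.Adj a b :=
    (hreg a haS b hbS (hav.trans hvb')).2 (Or.inr fun c hc => ⟨hamin c hc, hbmax c hc⟩)
  have hlong : (a : ℕ) + 1 < b := by rw [Fin.lt_def] at hav hvb'; omega
  obtain ⟨k, hak, hkb, hadjak, hadjkb, hk⟩ := hapex a b hab hlong
  -- Otherwise the side of `S` that passes over `k` would cross `ak` or `kb`, or be `ab` itself.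
  have hkS : k ∈ S := by
    by_contra hkS
    obtain ⟨c, hcS, hck, hcmax⟩ : ∃ c ∈ S, c < k ∧ ∀ e ∈ S, e < k → e ≤ c := by
      have hn : (S.filter (· < k)).Nonempty := ⟨a, by simp [haS, hak]⟩
      have := Finset.mem_filter.1 ((S.filter (· < k)).max'_mem hn)
      exact ⟨_, this.1, this.2, fun e he hek => Finset.le_max' _ _ (by simp [he, hek])⟩
    obtain ⟨d, hdS, hkd, hdmin⟩ : ∃ d ∈ S, k < d ∧ ∀ e ∈ S, k < e → d ≤ e := by
      have hn : (S.filter (k < ·)).Nonempty := ⟨b, by simp [hbS, hkb]⟩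
      have := Finset.mem_filter.1 ((S.filter (k < ·)).min'_mem hn)
      exact ⟨_, this.1, this.2, fun e he hek => Finset.min'_le _ _ (by simp [he, hek])⟩
    have hcd : G.Adj c d := by
      refine (hreg c hcS d hdS (hck.trans hkd)).2 (Or.inl ?_)
      rintro e he ⟨hce, hed⟩
      rcases lt_trichotomy e k with h | rfl | h
      · exact absurd (hcmax e he h) hce.not_ge
      · exact hkS he
      · exact absurd (hdmin e he h) hed.not_ge
    rcases (hamin c hcS).eq_or_lt with rfl | hac
    · rcases (hbmax d hdS).eq_or_lt with rfl | hdb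
      · rcases lt_trichotomy v k with h | rfl | h
        · exact absurd (hcmax v hvS h) hav.not_ge
        · exact hkS hvS
        · exact absurd (hdmin v hvS h) hvb'.not_ge
      · exact hG.2 a k d b hak hkd hdb ⟨hcd, hadjkb⟩
    · exact hG.2 a c k d hac hck hkd ⟨hadjak, hcd⟩
  refine ⟨a, k, b, ?_, hak, hkb, hk⟩
  ext e
  simp only [Finset.mem_insert, Finset.mem_singleton]
  constructor
  · intro he
    by_contra! hne
    have hae := lt_of_le_of_ne (hamin e he) hne.1.symm
    have heb := lt_of_le_of_ne (hbmax e he) hne.2.2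
    rcases lt_or_gt_of_ne hne.2.1 with h | h
    · rcases (hreg a haS k hkS hak).1 hadjak with h' | h'
      · exact h' e he ⟨hae, h⟩
      · exact absurd (h' b hbS).2 hkb.not_ge
    · rcases (hreg k hkS b hbS hkb).1 hadjkb with h' | h'
      · exact h' e he ⟨h, heb⟩
      · exact absurd (h' a haS).1 hak.not_ge
  · rintro (rfl | rfl | rfl) <;> assumption

/-- Local characterization of proper triangulations: each chord `ab` with `a + 1 < b` is the base
of a two-coloured triangle whose apex lies between `a` and `b`. -/
theorem isProperTriangulation_iff {m : ℕ} {G : SimpleGraph (Fin m)} :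
    IsProperTriangulation G ↔ IsPartition G ∧
      ∀ a b : Fin m, G.Adj a b → (a : ℕ) + 1 < b → ∃ k, a < k ∧ k < b ∧ G.Adj a k ∧
        G.Adj k b ∧ ¬ ((a : ℕ) % 2 = k % 2 ∧ (k : ℕ) % 2 = b % 2) := by
  constructor
  · exact fun h => ⟨h.1.1, fun a b hab hlt => exists_apex_of_isProperTriangulation h hab hlt⟩
  · rintro ⟨hG, hapex⟩
    refine ⟨⟨hG, fun S hS => ?_⟩, fun S hS => ?_⟩
    · obtain ⟨a, k, b, rfl, hak, hkb, -⟩ := exists_region_eq_apex hG hapex hS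
      exact Finset.card_eq_three.2 ⟨a, k, b, hak.ne, (hak.trans hkb).ne, hkb.ne, rfl⟩
    · obtain ⟨a, k, b, rfl, hak, hkb, hk⟩ := exists_region_eq_apex hG hapex hS
      rintro ⟨c, hc⟩
      have h1 := hc a (by simp)
      have h2 := hc k (by simp)
      have h3 := hc b (by simp)
      simp only [color] at h1 h2 h3
      omega

/-! ### Splitting a triangulation at the apex -/

/-- `E` is a proper triangulation of the polygon with vertices `i, i + 1, …, j`, coloured by
parity. A chord (or side) is coded by its end points `(a, b)` with `a < b`. -/
structure IsProperChordSet (i j : ℕ) (E : Finset (ℕ × ℕ)) : Prop where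
  bounds : ∀ a b, (a, b) ∈ E → i ≤ a ∧ a < b ∧ b ≤ j
  base : (i, j) ∈ E
  side : ∀ a, i ≤ a → a < j → (a, a + 1) ∈ E
  noncrossing : ∀ a b c d, a < b → b < c → c < d → (a, c) ∈ E → (b, d) ∈ E → False
  apex : ∀ a b, (a, b) ∈ E → a + 1 < b → ∃ k, a < k ∧ k < b ∧ (a, k) ∈ E ∧ (k, b) ∈ E ∧
    ¬ (a % 2 = k % 2 ∧ k % 2 = b % 2)

open Classical in
/-- The finite set of all proper triangulations of the polygon with vertices `i, …, j`. -/
noncomputable def properChordSets (i j : ℕ) : Finset (Finset (ℕ × ℕ)) :=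
  (Finset.Icc i j ×ˢ Finset.Icc i j).powerset.filter (IsProperChordSet i j)

theorem mem_properChordSets {i j : ℕ} {E : Finset (ℕ × ℕ)} :
    E ∈ properChordSets i j ↔ IsProperChordSet i j E := by
  classical
  simp only [properChordSets, Finset.mem_filter, Finset.mem_powerset, and_iff_right_iff_imp]
  rintro h ⟨a, b⟩ hab
  have := h.bounds a b hab
  simp only [Finset.mem_product, Finset.mem_Icc]
  omega

theorem card_properChordSets_succ (i : ℕ) : (properChordSets i (i + 1)).card = 1 := by
  rw [Finset.card_eq_one]
  refine ⟨{(i, i + 1)}, ?_⟩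
  ext E
  rw [mem_properChordSets, Finset.mem_singleton]
  constructor
  · intro h
    ext ⟨a, b⟩
    rw [Finset.mem_singleton, Prod.mk.injEq]
    constructor
    · intro hab
      have := h.bounds a b hab
      omega
    · rintro ⟨rfl, rfl⟩
      exact h.base
  · rintro rfl
    constructor <;> simp only [Finset.mem_singleton, Prod.mk.injEq] <;> intros <;> omega

theorem IsProperChordSet.glue {i k j : ℕ} {A B : Finset (ℕ × ℕ)} (hA : IsProperChordSet i k A)
    (hB : IsProperChordSet k j B) (hik : i < k) (hkj : k < j)
    (hcol : ¬ (i % 2 = k % 2 ∧ k % 2 = j % 2)) :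
    IsProperChordSet i j (insert (i, j) (A ∪ B)) := by
  have hmem : ∀ a b, (a, b) ∈ insert (i, j) (A ∪ B) ↔
      (a = i ∧ b = j) ∨ (a, b) ∈ A ∨ (a, b) ∈ B := by
    intro a b; simp
  constructor
  · intro a b hab
    rcases (hmem a b).1 hab with h | h | h
    · omega
    · have := hA.bounds a b h; omega
    · have := hB.bounds a b h; omega
  · simp
  · intro a hia haj
    rw [hmem]
    rcases lt_or_ge a k with h | h
    · exact Or.inr (Or.inl (hA.side a hia h))
    · exact Or.inr (Or.inr (hB.side a h haj))
  · intro a b c d hab hbc hcd hac hbd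
    rcases (hmem a c).1 hac with h | h | h <;> rcases (hmem b d).1 hbd with h' | h' | h'
    · omega
    · have := hA.bounds b d h'; omega
    · have := hB.bounds b d h'; omega
    · have := hA.bounds a c h; omega
    · exact hA.noncrossing a b c d hab hbc hcd h h'
    · have := hA.bounds a c h; have := hB.bounds b d h'; omega
    · have := hB.bounds a c h; omega
    · have := hB.bounds a c h; have := hA.bounds b d h'; omega
    · exact hB.noncrossing a b c d hab hbc hcd h h'
  · intro a b hab hlt
    rcases (hmem a b).1 hab with ⟨rfl, rfl⟩ | h | h
    · exact ⟨k, hik, hkj, (hmem _ _).2 (Or.inr (Or.inl hA.base)),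
        (hmem _ _).2 (Or.inr (Or.inr hB.base)), hcol⟩
    · obtain ⟨l, h1, h2, h3, h4, h5⟩ := hA.apex a b h hlt
      exact ⟨l, h1, h2, (hmem _ _).2 (Or.inr (Or.inl h3)), (hmem _ _).2 (Or.inr (Or.inl h4)), h5⟩
    · obtain ⟨l, h1, h2, h3, h4, h5⟩ := hB.apex a b h hlt
      exact ⟨l, h1, h2, (hmem _ _).2 (Or.inr (Or.inr h3)), (hmem _ _).2 (Or.inr (Or.inr h4)), h5⟩

theorem IsProperChordSet.restrict {i j a b : ℕ} {E : Finset (ℕ × ℕ)} (h : IsProperChordSet i j E)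
    (hab : (a, b) ∈ E) :
    IsProperChordSet a b (E.filter fun p => a ≤ p.1 ∧ p.2 ≤ b) := by
  have hb := h.bounds a b hab
  constructor
  · intro c d hcd
    have hcd := Finset.mem_filter.1 hcd
    have := h.bounds c d hcd.1
    simp only at hcd
    omega
  · simp [hab]
  · intro c hac hcb
    refine Finset.mem_filter.2 ⟨h.side c (by omega) (by omega), hac, hcb⟩
  · intro c d e f hcd hde hef h1 h2
    exact h.noncrossing c d e f hcd hde hef (Finset.mem_filter.1 h1).1 (Finset.mem_filter.1 h2).1
  · intro c d hcd hlt
    have hcd := Finset.mem_filter.1 hcd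
    simp only at hcd
    obtain ⟨l, h1, h2, h3, h4, h5⟩ := h.apex c d hcd.1 hlt
    exact ⟨l, h1, h2, Finset.mem_filter.2 ⟨h3, by simp only; omega⟩,
      Finset.mem_filter.2 ⟨h4, by simp only; omega⟩, h5⟩

theorem filter_glue_left {i k j : ℕ} {A B : Finset (ℕ × ℕ)} (hA : IsProperChordSet i k A)
    (hB : IsProperChordSet k j B) (hkj : k < j) :
    (insert (i, j) (A ∪ B)).filter (fun p => i ≤ p.1 ∧ p.2 ≤ k) = A := by
  ext ⟨a, b⟩
  simp only [Finset.mem_filter, Finset.mem_insert, Finset.mem_union, Prod.mk.injEq]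
  constructor
  · rintro ⟨h | h | h, h'⟩
    · omega
    · exact h
    · have := hB.bounds a b h; omega
  · intro h
    have := hA.bounds a b h
    exact ⟨Or.inr (Or.inl h), by omega⟩

theorem filter_glue_right {i k j : ℕ} {A B : Finset (ℕ × ℕ)} (hA : IsProperChordSet i k A)
    (hB : IsProperChordSet k j B) (hik : i < k) :
    (insert (i, j) (A ∪ B)).filter (fun p => k ≤ p.1 ∧ p.2 ≤ j) = B := by
  ext ⟨a, b⟩
  simp only [Finset.mem_filter, Finset.mem_insert, Finset.mem_union, Prod.mk.injEq]
  constructor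
  · rintro ⟨h | h | h, h'⟩
    · omega
    · have := hA.bounds a b h; omega
    · exact h
  · intro h
    have := hB.bounds a b h
    exact ⟨Or.inr (Or.inr h), by omega⟩

theorem IsProperChordSet.glue_restrict {i k j : ℕ} {E : Finset (ℕ × ℕ)}
    (h : IsProperChordSet i j E) (hik : (i, k) ∈ E) (hkj : (k, j) ∈ E) :
    insert (i, j) (E.filter (fun p => i ≤ p.1 ∧ p.2 ≤ k) ∪
      E.filter fun p => k ≤ p.1 ∧ p.2 ≤ j) = E := by
  have h1 := h.bounds i k hik
  have h2 := h.bounds k j hkj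
  ext ⟨a, b⟩
  simp only [Finset.mem_filter, Finset.mem_insert, Finset.mem_union, Prod.mk.injEq]
  constructor
  · rintro (⟨rfl, rfl⟩ | h' | h')
    · exact h.base
    · exact h'.1
    · exact h'.1
  · intro hab
    have h3 := h.bounds a b hab
    by_cases hbk : b ≤ k
    · exact Or.inr (Or.inl ⟨hab, by omega⟩)
    by_cases hka : k ≤ a
    · exact Or.inr (Or.inr ⟨hab, by omega⟩)
    -- A chord that passes over `k` and is not `(i, j)` crosses `(i, k)` or `(k, j)`.
    left
    by_contra hne
    by_cases hia : i < a
    · exact h.noncrossing i a k b hia (by omega) (by omega) hik hab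
    · exact h.noncrossing a k b j (by omega) (by omega) (by omega) hab hkj

theorem IsProperChordSet.apex_le {i j k l : ℕ} {E : Finset (ℕ × ℕ)} (h : IsProperChordSet i j E)
    (hil : (i, l) ∈ E) (hkj : (k, j) ∈ E) (hik : i < k) (hlj : l < j) : l ≤ k :=
  not_lt.1 fun hkl => h.noncrossing i k l j hik hkl hlj hil hkj

/-- The recurrence: a proper triangulation consists of the triangle on the base `(i, j)` and of
proper triangulations on both sides of its apex `k`. -/
theorem card_properChordSets {i j : ℕ} (hij : i + 1 < j) :
    (properChordSets i j).card =
      ∑ k ∈ (Finset.Ioo i j).filter (fun k => ¬ (i % 2 = k % 2 ∧ k % 2 = j % 2)),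
        (properChordSets i k).card * (properChordSets k j).card := by
  classical
  simp_rw [← Finset.card_product]
  rw [← Finset.card_sigma]
  symm
  apply Finset.card_nbij (fun x => insert (i, j) (x.2.1 ∪ x.2.2))
  · rintro ⟨k, A, B⟩ hx
    simp only [Finset.coe_sigma, Set.mem_sigma_iff, Finset.mem_coe, Finset.mem_filter,
      Finset.mem_Ioo, Finset.mem_product, mem_properChordSets] at hx ⊢
    exact hx.2.1.glue hx.2.2 hx.1.1.1 hx.1.1.2 hx.1.2
  · rintro ⟨k, A, B⟩ hx ⟨l, C, D⟩ hy hxy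
    simp only [Finset.coe_sigma, Set.mem_sigma_iff, Finset.mem_coe, Finset.mem_filter,
      Finset.mem_Ioo, Finset.mem_product, mem_properChordSets] at hx hy hxy
    obtain ⟨⟨⟨hik, hkj⟩, hk⟩, hA, hB⟩ := hx
    obtain ⟨⟨⟨hil, hlj⟩, hl⟩, hC, hD⟩ := hy
    have hE := hA.glue hB hik hkj hk
    have hE' := hC.glue hD hil hlj hl
    have hkl : k = l := by
      apply le_antisymm
      · exact hE'.apex_le (by rw [← hxy]; simp [hA.base]) (by simp [hD.base]) hil hkj
      · exact hE.apex_le (by rw [hxy]; simp [hC.base]) (by simp [hB.base]) hik hlj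
    subst hkl
    have h1 : A = C := by rw [← filter_glue_left hA hB hkj, hxy, filter_glue_left hC hD hkj]
    have h2 : B = D := by rw [← filter_glue_right hA hB hik, hxy, filter_glue_right hC hD hik]
    rw [h1, h2]
  · intro E hE
    have hE := mem_properChordSets.1 hE
    obtain ⟨k, hik, hkj, h1, h2, hk⟩ := hE.apex i j hE.base hij
    refine ⟨⟨k, E.filter (fun p => i ≤ p.1 ∧ p.2 ≤ k), E.filter fun p => k ≤ p.1 ∧ p.2 ≤ j⟩,
      ?_, hE.glue_restrict h1 h2⟩
    simp only [Finset.coe_sigma, Set.mem_sigma_iff, Finset.mem_coe, Finset.mem_filter,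
      Finset.mem_Ioo, Finset.mem_product, mem_properChordSets]
    exact ⟨⟨⟨hik, hkj⟩, hk⟩, hE.restrict h1, hE.restrict h2⟩

/-- Shifting the polygon by `i` preserves the number of proper triangulations, even where it
exchanges the two colours. -/
theorem card_properChordSets_add (l i : ℕ) :
    (properChordSets i (i + l + 1)).card = (properChordSets 0 (l + 1)).card := by
  induction l using Nat.strong_induction_on generalizing i with
  | _ l ih =>
    rcases Nat.eq_zero_or_pos l with rfl | hl
    · rw [add_zero, card_properChordSets_succ, card_properChordSets_succ]
    rw [card_properChordSets (by omega), card_properChordSets (by omega)]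
    symm
    apply Finset.sum_nbij' (fun k => i + k) (fun k => k - i)
    · intro k hk
      simp only [Finset.mem_filter, Finset.mem_Ioo] at hk ⊢
      omega
    · intro k hk
      simp only [Finset.mem_filter, Finset.mem_Ioo] at hk ⊢
      omega
    · intro k _; simp
    · intro k hk
      simp only [Finset.mem_filter, Finset.mem_Ioo] at hk
      omega
    · intro k hk
      simp only [Finset.mem_filter, Finset.mem_Ioo] at hk
      have e1 := ih (k - 1) (by omega) i
      have e2 := ih (l - k) (by omega) k
      have e3 := ih (l - k) (by omega) (i + k)
      rw [show i + (k - 1) + 1 = i + k by omega, show k - 1 + 1 = k by omega] at e1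
      rw [show k + (l - k) + 1 = l + 1 by omega] at e2
      rw [show i + k + (l - k) + 1 = i + l + 1 by omega] at e3
      rw [e1, e2, e3]

/-! ### From graphs to sets of chords -/

/-- The graph on the vertices of the `m`-gon whose edges are the chords in `E`. -/
def chordGraph (m : ℕ) (E : Finset (ℕ × ℕ)) : SimpleGraph (Fin m) :=
  SimpleGraph.fromRel fun a b => ((a : ℕ), (b : ℕ)) ∈ E

theorem chordGraph_adj_of_lt {m i j : ℕ} {E : Finset (ℕ × ℕ)} (hE : IsProperChordSet i j E)
    {a b : Fin m} (hab : a < b) : (chordGraph m E).Adj a b ↔ ((a : ℕ), (b : ℕ)) ∈ E := by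
  rw [chordGraph, SimpleGraph.fromRel_adj]
  constructor
  · rintro ⟨-, h | h⟩
    · exact h
    · have := hE.bounds _ _ h
      rw [Fin.lt_def] at hab
      omega
  · exact fun h => ⟨hab.ne, Or.inl h⟩

theorem cycleGraph_adj_of_lt {N : ℕ} {a b : Fin (N + 2)} (hab : a < b) :
    (SimpleGraph.cycleGraph (N + 2)).Adj a b ↔
      (a : ℕ) + 1 = b ∨ ((a : ℕ) = 0 ∧ (b : ℕ) = N + 1) := by
  rw [SimpleGraph.cycleGraph_adj', Fin.sub_val_of_le hab.le, Fin.coe_sub_iff_lt.2 hab]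
  have := a.2
  have := b.2
  rw [Fin.lt_def] at hab
  omega

theorem le_iff_of_lt {m : ℕ} {G H : SimpleGraph (Fin m)} :
    G ≤ H ↔ ∀ a b, a < b → G.Adj a b → H.Adj a b := by
  constructor
  · exact fun h a b _ hab => h hab
  · intro h a b hab
    rcases lt_or_gt_of_ne hab.ne with hlt | hlt
    · exact h a b hlt hab
    · exact (h b a hlt hab.symm).symm

theorem IsProperChordSet.isProperTriangulation {N : ℕ} {E : Finset (ℕ × ℕ)}
    (hE : IsProperChordSet 0 (N + 1) E) : IsProperTriangulation (chordGraph (N + 2) E) := by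
  rw [isProperTriangulation_iff]
  refine ⟨⟨?_, ?_⟩, ?_⟩
  · rw [le_iff_of_lt]
    intro a b hab h
    rw [chordGraph_adj_of_lt hE hab]
    have hb := b.2
    rw [Fin.lt_def] at hab
    rcases (cycleGraph_adj_of_lt hab).1 h with h | ⟨h1, h2⟩
    · rw [← h]
      exact hE.side a (Nat.zero_le _) (by omega)
    · rw [h1, h2]
      exact hE.base
  · rintro a b c d hab hbc hcd ⟨hac, hbd⟩
    rw [chordGraph_adj_of_lt hE (hab.trans hbc)] at hac
    rw [chordGraph_adj_of_lt hE (hbc.trans hcd)] at hbd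
    exact hE.noncrossing _ _ _ _ hab hbc hcd hac hbd
  · intro a b hab hlt
    have hab' : a < b := by rw [Fin.lt_def]; omega
    rw [chordGraph_adj_of_lt hE hab'] at hab
    obtain ⟨k, h1, h2, h3, h4, h5⟩ := hE.apex _ _ hab hlt
    have hk : k < N + 2 := h2.trans b.2
    refine ⟨⟨k, hk⟩, h1, h2, ?_, ?_, h5⟩
    · rw [chordGraph_adj_of_lt hE (show a < ⟨k, hk⟩ from h1)]
      exact h3
    · rw [chordGraph_adj_of_lt hE (show ⟨k, hk⟩ < b from h2)]
      exact h4

theorem IsProperTriangulation.exists_chordGraph_eq {N : ℕ} {G : SimpleGraph (Fin (N + 2))}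
    (hG : IsProperTriangulation G) :
    ∃ E, IsProperChordSet 0 (N + 1) E ∧ chordGraph (N + 2) E = G := by
  classical
  obtain ⟨⟨hside, hcross⟩, hapex⟩ := isProperTriangulation_iff.1 hG
  let E : Finset (ℕ × ℕ) :=
    ((Finset.univ : Finset (Fin (N + 2) × Fin (N + 2))).filter
      fun p => p.1 < p.2 ∧ G.Adj p.1 p.2).image fun p => ((p.1 : ℕ), (p.2 : ℕ))
  have hmem : ∀ a b, (a, b) ∈ E ↔
      ∃ x y : Fin (N + 2), x < y ∧ G.Adj x y ∧ (x : ℕ) = a ∧ (y : ℕ) = b := by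
    intro a b
    simp only [E, Finset.mem_image, Finset.mem_filter, Finset.mem_univ, true_and, Prod.exists,
      Prod.mk.injEq, and_assoc]
  have hE : IsProperChordSet 0 (N + 1) E := by
    constructor
    · intro a b hab
      obtain ⟨x, y, hxy, -, rfl, rfl⟩ := (hmem a b).1 hab
      have := y.2
      rw [Fin.lt_def] at hxy
      omega
    · refine (hmem _ _).2 ⟨0, Fin.last _, Fin.last_pos, hside ?_, by simp, by simp⟩
      rw [cycleGraph_adj_of_lt Fin.last_pos]
      simp
    · intro a _ ha
      have hlt : (⟨a, by omega⟩ : Fin (N + 2)) < ⟨a + 1, by omega⟩ := by simp [Fin.lt_def]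
      refine (hmem _ _).2 ⟨_, _, hlt, hside ?_, rfl, rfl⟩
      rw [cycleGraph_adj_of_lt hlt]
      simp
    · intro a b c d hab hbc hcd hac hbd
      obtain ⟨x, z, -, hxz, rfl, rfl⟩ := (hmem _ _).1 hac
      obtain ⟨y, w, -, hyw, rfl, rfl⟩ := (hmem _ _).1 hbd
      exact hcross x y z w hab hbc hcd ⟨hxz, hyw⟩
    · intro a b hab hlt
      obtain ⟨x, y, hxy, hadj, rfl, rfl⟩ := (hmem _ _).1 hab
      obtain ⟨k, h1, h2, h3, h4, h5⟩ := hapex x y hadj hlt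
      exact ⟨k, h1, h2, (hmem _ _).2 ⟨x, k, h1, h3, rfl, rfl⟩,
        (hmem _ _).2 ⟨k, y, h2, h4, rfl, rfl⟩, h5⟩
  have hadj : ∀ a b, a < b → ((chordGraph (N + 2) E).Adj a b ↔ G.Adj a b) := by
    intro a b hab
    rw [chordGraph_adj_of_lt hE hab, hmem]
    constructor
    · rintro ⟨x, y, -, h, hx, hy⟩
      rwa [Fin.ext hx, Fin.ext hy] at h
    · exact fun h => ⟨a, b, hab, h, rfl, rfl⟩
  exact ⟨E, hE, le_antisymm (le_iff_of_lt.2 fun a b hab => (hadj a b hab).1)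
    (le_iff_of_lt.2 fun a b hab => (hadj a b hab).2)⟩

theorem numProper_eq_card (N : ℕ) : numProper N = (properChordSets 0 (N + 1)).card := by
  rw [numProper, ← Set.ncard_coe_finset]
  symm
  apply Set.ncard_congr fun E _ => chordGraph (N + 2) E
  · intro E hE
    exact (mem_properChordSets.1 hE).isProperTriangulation
  · intro E E' hE hE' h
    have hE := mem_properChordSets.1 hE
    have hE' := mem_properChordSets.1 hE'
    ext ⟨a, b⟩
    by_cases hab : a < b ∧ b < N + 2
    · have hlt : (⟨a, hab.1.trans hab.2⟩ : Fin (N + 2)) < ⟨b, hab.2⟩ := hab.1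
      have e1 := chordGraph_adj_of_lt hE hlt
      have e2 := chordGraph_adj_of_lt hE' hlt
      rw [← e1, ← e2, h]
    · constructor
      · intro h'
        have := hE.bounds a b h'
        omega
      · intro h'
        have := hE'.bounds a b h'
        omega
  · intro G hG
    obtain ⟨E, hE, h⟩ := IsProperTriangulation.exists_chordGraph_eq hG
    exact ⟨E, mem_properChordSets.2 hE, h⟩

/-! ### Recurrences by parity -/

theorem numProper_zero : numProper 0 = 1 := by
  rw [numProper_eq_card, card_properChordSets_succ]

/-- In terms of `p.1 = k - 1` and `p.2 = N + 1 - k`, the triangle `0, k, N + 2` is monochromatic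
exactly if `p.1` and `p.2` are both odd. -/
theorem numProper_succ (N : ℕ) :
    numProper (N + 1) =
    ∑ p ∈ (Finset.HasAntidiagonal.antidiagonal N).filter fun p => p.1 % 2 = 0 ∨ p.2 % 2 = 0,
      numProper p.1 * numProper p.2 := by
  rw [numProper_eq_card, card_properChordSets (by omega)]
  apply Finset.sum_nbij' (fun k => (k - 1, N + 1 - k)) (fun p => p.1 + 1)
  · intro k hk
    simp only [Finset.mem_filter, Finset.mem_Ioo, Finset.HasAntidiagonal.mem_antidiagonal] at hk ⊢
    omega
  · rintro ⟨p, q⟩ hp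
    simp only [Finset.mem_filter, Finset.mem_Ioo, Finset.HasAntidiagonal.mem_antidiagonal] at hp ⊢
    omega
  · intro k hk
    simp only [Finset.mem_filter, Finset.mem_Ioo] at hk
    omega
  · rintro ⟨p, q⟩ hp
    simp only [Finset.mem_filter, Finset.HasAntidiagonal.mem_antidiagonal, Prod.mk.injEq] at hp ⊢
    omega
  · intro k hk
    simp only [Finset.mem_filter, Finset.mem_Ioo] at hk
    have e := card_properChordSets_add (N + 1 - k) k
    rw [show k + (N + 1 - k) + 1 = N + 1 + 1 by omega] at e
    rw [numProper_eq_card, numProper_eq_card, e, show k - 1 + 1 = k by omega]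

theorem numProper_odd (n : ℕ) : numProper (2 * n + 1) =
    ∑ p ∈ Finset.HasAntidiagonal.antidiagonal n, numProper (2 * p.1) * numProper (2 * p.2) := by
  rw [numProper_succ]
  symm
  apply Finset.sum_nbij' (fun p => (2 * p.1, 2 * p.2)) (fun p => (p.1 / 2, p.2 / 2))
  · rintro ⟨p, q⟩ hp
    simp only [Finset.mem_filter, Finset.HasAntidiagonal.mem_antidiagonal] at hp ⊢
    omega
  · rintro ⟨p, q⟩ hp
    simp only [Finset.mem_filter, Finset.HasAntidiagonal.mem_antidiagonal] at hp ⊢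
    omega
  · rintro ⟨p, q⟩ hp
    simp
  · rintro ⟨p, q⟩ hp
    simp only [Finset.mem_filter, Finset.HasAntidiagonal.mem_antidiagonal, Prod.mk.injEq] at hp ⊢
    omega
  · intros; rfl

theorem numProper_even_succ (n : ℕ) : numProper (2 * (n + 1)) =
    2 * ∑ p ∈ Finset.HasAntidiagonal.antidiagonal n,
      numProper (2 * p.1) * numProper (2 * p.2 + 1) := by
  rw [show 2 * (n + 1) = 2 * n + 1 + 1 by ring, numProper_succ, two_mul (Finset.sum _ _),
    ← Finset.sum_filter_add_sum_filter_not _ (fun p => p.1 % 2 = 0)]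
  congr 1
  · symm
    apply Finset.sum_nbij' (fun p => (2 * p.1, 2 * p.2 + 1)) (fun p => (p.1 / 2, p.2 / 2))
    · rintro ⟨p, q⟩ hp
      simp only [Finset.mem_filter, Finset.HasAntidiagonal.mem_antidiagonal] at hp ⊢
      omega
    · rintro ⟨p, q⟩ hp
      simp only [Finset.mem_filter, Finset.HasAntidiagonal.mem_antidiagonal] at hp ⊢
      omega
    · rintro ⟨p, q⟩ hp
      simp only [Prod.mk.injEq]
      omega
    · rintro ⟨p, q⟩ hp
      simp only [Finset.mem_filter, Finset.HasAntidiagonal.mem_antidiagonal, Prod.mk.injEq] at hp ⊢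
      omega
    · intros; rfl
  · -- The terms with `p.1` odd are those with `p.1` even, with the two factors exchanged.
    symm
    apply Finset.sum_nbij' (fun p => (2 * p.2 + 1, 2 * p.1)) (fun p => (p.2 / 2, p.1 / 2))
    · rintro ⟨p, q⟩ hp
      simp only [Finset.mem_filter, Finset.HasAntidiagonal.mem_antidiagonal] at hp ⊢
      omega
    · rintro ⟨p, q⟩ hp
      simp only [Finset.mem_filter, Finset.HasAntidiagonal.mem_antidiagonal] at hp ⊢
      omega
    · rintro ⟨p, q⟩ hp
      simp only [Prod.mk.injEq]
      omega
    · rintro ⟨p, q⟩ hp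
      simp only [Finset.mem_filter, Finset.HasAntidiagonal.mem_antidiagonal, Prod.mk.injEq] at hp ⊢
      omega
    · intros; exact mul_comm _ _

end PolygonPartition

/-! ### The cubic equation for the generating function -/

open PowerSeries in
/-- Coefficients of the powers of a solution of `F = 1 + 2 X F³`. Both sides satisfy the recurrence
that comes from `F ^ (r + 1) = F ^ r + 2 X F ^ (r + 3)`. -/
theorem coeff_pow_of_eq_one_add_two_X_mul_cube {F : PowerSeries ℚ}
    (hF : F = 1 + 2 * X * F ^ 3) (n r : ℕ) :
    (3 * n + r : ℚ) * coeff n (F ^ r) = 2 ^ n * r * ((3 * n + r).choose n : ℚ) := by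
  have hrec : ∀ r, F ^ (r + 1) = F ^ r + 2 * (X * F ^ (r + 3)) := by
    intro r
    calc F ^ (r + 1) = F ^ r * F := pow_succ F r
      _ = F ^ r * (1 + 2 * X * F ^ 3) := by rw [← hF]
      _ = _ := by ring
  have h2 : ∀ (k : ℕ) (A : PowerSeries ℚ), coeff k (2 * A) = 2 * coeff k A := by
    intro k A
    rw [two_mul, two_mul, map_add]
  induction n generalizing r with
  | zero =>
    have h0 : constantCoeff F = 1 := by
      have := congrArg constantCoeff hF
      simpa using this
    simp [h0]
  | succ n ihn =>
    induction r with
    | zero => simp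
    | succ r ihr =>
      rw [hrec, map_add, h2, coeff_succ_X_mul]
      have e1 := ihn (r + 3)
      have e2 := ihr
      -- Both binomials of the recurrence are expressed through `C` and `D`.
      obtain ⟨C, hC⟩ : ∃ C : ℚ, C = ((3 * n + r + 3).choose n : ℚ) := ⟨_, rfl⟩
      obtain ⟨D, hD⟩ : ∃ D : ℚ, D = ((3 * n + r + 3).choose (n + 1) : ℚ) := ⟨_, rfl⟩
      have hP : ((3 * (n + 1) + (r + 1)).choose (n + 1) : ℚ) = C + D := by
        rw [hC, hD, ← Nat.cast_add, ← Nat.choose_succ_succ,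
          show 3 * (n + 1) + (r + 1) = (3 * n + r + 3).succ by omega]
      have hCD : D * (n + 1) = C * (2 * n + r + 3) := by
        have := Nat.choose_succ_right_eq (3 * n + r + 3) n
        rw [show 3 * n + r + 3 - n = 2 * n + r + 3 by omega] at this
        rw [hC, hD]
        exact_mod_cast this
      rw [show 3 * n + (r + 3) = 3 * n + r + 3 by ring, ← hC] at e1
      rw [show 3 * (n + 1) + r = 3 * n + r + 3 by ring, ← hD] at e2
      rw [hP]
      push_cast at e1 e2 ⊢
      have hpos : (3 * n + r + 3 : ℚ) ≠ 0 := by positivity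
      have hpos' : (n + 1 : ℚ) ≠ 0 := by positivity
      have e1' : coeff n (F ^ (r + 3)) = 2 ^ n * (r + 3) * C / (3 * n + r + 3) := by
        rw [eq_div_iff hpos]; linear_combination e1
      have e2' : coeff (n + 1) (F ^ r) = 2 ^ (n + 1) * r * D / (3 * n + r + 3) := by
        rw [eq_div_iff hpos]; linear_combination e2
      have hD' : D = C * (2 * n + r + 3) / (n + 1) := by
        rw [eq_div_iff hpos']; exact hCD
      rw [e1', e2', hD']
      field_simp
      ring

namespace PolygonPartition

/-- The generating function `∑ aₙ Xⁿ` of the numbers `aₙ` of proper triangulations of the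
`(2 n + 2)`-gon. -/
noncomputable def evenSeries : PowerSeries ℚ :=
  PowerSeries.mk fun n => (numProper (2 * n) : ℚ)

theorem coeff_evenSeries_sq (n : ℕ) :
    PowerSeries.coeff n (evenSeries ^ 2) = (numProper (2 * n + 1) : ℚ) := by
  rw [sq, PowerSeries.coeff_mul, numProper_odd]
  simp [evenSeries]

theorem evenSeries_eq :
    evenSeries = 1 + 2 * PowerSeries.X * evenSeries ^ 3 := by
  ext n
  rw [mul_assoc, two_mul, pow_succ']
  cases n with
  | zero => simp [evenSeries, numProper_zero]
  | succ n =>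
    rw [map_add, map_add, PowerSeries.coeff_succ_X_mul, PowerSeries.coeff_mul, ← two_mul]
    simp_rw [coeff_evenSeries_sq]
    simp only [evenSeries, PowerSeries.coeff_mk, PowerSeries.coeff_one]
    rw [numProper_even_succ]
    simp

end PolygonPartition

theorem theorem2p1 (n : ℕ) :
    (PolygonPartition.numProper (2 * n) : ℚ) =
        2 ^ n / (2 * (n : ℚ) + 1) * ((3 * n).choose n : ℚ) ∧
      (PolygonPartition.numProper (2 * n + 1) : ℚ) =
        2 ^ (n + 1) / (2 * (n : ℚ) + 2) * ((3 * n + 1).choose n : ℚ) := by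
  have key := coeff_pow_of_eq_one_add_two_X_mul_cube PolygonPartition.evenSeries_eq n
  have h1 := key 1
  have h2 := key 2
  rw [PolygonPartition.coeff_evenSeries_sq] at h2
  rw [pow_one, PolygonPartition.evenSeries, PowerSeries.coeff_mk] at h1
  -- `(2 n + 1) C(3 n + 1, n) = (3 n + 1) C(3 n, n)`, and likewise with `3 n + 2`.
  have c1 := Nat.choose_mul_succ_eq (3 * n) n
  have c2 := Nat.choose_mul_succ_eq (3 * n + 1) n
  rw [show 3 * n + 1 - n = 2 * n + 1 by omega] at c1
  rw [show 3 * n + 1 + 1 - n = 2 * n + 2 by omega] at c2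
  have c1' : ((3 * n).choose n : ℚ) * (3 * n + 1) = (3 * n + 1).choose n * (2 * n + 1) := by
    exact_mod_cast c1
  have c2' : ((3 * n + 1).choose n : ℚ) * (3 * n + 1 + 1) =
      (3 * n + 2).choose n * (2 * n + 2) := by
    exact_mod_cast c2
  push_cast at h1 h2
  constructor
  · rw [div_mul_eq_mul_div, eq_div_iff (by positivity)]
    apply mul_left_cancel₀ (show (3 * n + 1 : ℚ) ≠ 0 by positivity)
    linear_combination (2 * n + 1 : ℚ) * h1 - 2 ^ n * c1'
  · rw [div_mul_eq_mul_div, eq_div_iff (by positivity)]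
    apply mul_left_cancel₀ (show (3 * n + 2 : ℚ) ≠ 0 by positivity)
    linear_combination (2 * n + 2 : ℚ) * h2 - 2 ^ (n + 1) * c2'
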